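/- Let $N\ge 1$. Write $\nabla_k$ for the weak gradient in the variable $x_k\in\mathbb R^3$ and let $W_N$ be the set of antisymmetric $\psi\in H^1(\mathbb R^{3N};\mathbb C)$ with $\|\psi\|_{L^2}=1$. For $\psi\in W_N$ put $$\rho_\psi(x)=N\int_{\mathbb R^{3(N-1)}}|\psi(x,x_2,\dots,x_N)|^2\,dx_2\cdots dx_N,$$ $$j^p_\psi(x)=N\,\mathrm{Im}\int_{\mathbb R^{3(N-1)}}\psi^*(x,x_2,\dots,x_N)\,\nabla_x\psi(x,x_2,\dots,x_N)\,dx_2\cdots dx_N,$$ $$\langle\psi,K\psi\rangle=\sum_{k=1}^N\int_{\mathbb R^{3N}}|\nabla_k\psi|^2,\qquad \langle\psi,H_0\psi\rangle=\langle\psi,K\psi\rangle+\sum_{1\le k<l\le N}\int_{\mathbb R^{3N}}\frac{|\psi|^2}{|x_k-x_l|},$$ and write $\psi\mapsto(\rho,j^p)$ if $\rho_\psi=\rho$ and $j^p_\psi=j^p$ almost everywhere. Let $Y_N$ be the set of pairs $(\rho,j^p)$ with $\rho\ge0$, $\int_{\mathbb R^3}\rho=N$, $\rho^{1/2}\in H^1(\mathbb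 R^3)$, $j^p\in (L^1(\mathbb R^3))^3$ and $\int_{\mathbb R^3}|j^p|^2\rho^{-1}<\infty$ (where $0/0=0$ and $a/0=\infty$ for $a>0$). **Theorem.** Let $(\rho,j^p)\in Y_N$ be $N$-representable, i.e. suppose that at least one $\psi\in W_N$ satisfies $\psi\mapsto(\rho,j^p)$, and set $$Q(\rho,j^p)=\inf\{\langle\psi,H_0\psi\rangle : \psi\in W_N,\ \psi\mapsto(\rho,j^p)\},\qquad Q'(\rho,j^p)=\inf\{\langle\psi,K\psi\rangle : \psi\in W_N,\ \psi\mapsto(\rho,j^p)\}.$$ Then (i) there is a $\psi_m\in W_N$ with $\psi_m\mapsto(\rho,j^p)$ and $Q(\rho,j^p)=\langle\psi_m,H_0\psi_m\rangle$; and (ii) there is a $\psi_m'\in W_N$ with $\psi_m'\mapsto(\rho,j^p)$ and $Q'(\rho,j^p)=\langle\psi_m',K\psi_m'\rangle$. -/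

import Mathlib

open MeasureTheory
open scoped ENNReal ContDiff

namespace CDFT

noncomputable section

/-! ### Weak derivatives and the Sobolev space H¹ -/

/-- `g` is a weak derivative of `f` in the direction `v`: both are locally integrable and
`∫ (∂_v φ) f = - ∫ φ g` for every real-valued smooth compactly supported `φ`. -/
def HasWeakDeriv {E F : Type*} [NormedAddCommGroup E] [NormedSpace ℝ E] [MeasureSpace E]
    [NormedAddCommGroup F] [NormedSpace ℝ F] (f : E → F) (v : E) (g : E → F) : Prop :=
  LocallyIntegrable f volume ∧ LocallyIntegrable g volume ∧
    ∀ φ : E → ℝ, ContDiff ℝ ∞ φ → HasCompactSupport φ →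
      ∫ x, (fderiv ℝ φ x v) • f x = - ∫ x, φ x • g x

/-- `f ∈ L²` with all first-order weak derivatives in `L²`. -/
def MemH1 {E F : Type*} [NormedAddCommGroup E] [NormedSpace ℝ E] [MeasureSpace E]
    [NormedAddCommGroup F] [NormedSpace ℝ F] (f : E → F) : Prop :=
  MemLp f 2 volume ∧ ∀ v : E, ∃ g : E → F, HasWeakDeriv f v g ∧ MemLp g 2 volume

open Classical in
/-- The weak derivative of `f` in the direction `v` (it is unique up to a null set);
by convention `0` if there is none. -/
def weakDeriv {E F : Type*} [NormedAddCommGroup E] [NormedSpace ℝ E] [MeasureSpace E]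
    [NormedAddCommGroup F] [NormedSpace ℝ F] (f : E → F) (v : E) : E → F :=
  if h : ∃ g : E → F, HasWeakDeriv f v g then h.choose else 0

/-! ### Wave functions of `N = n + 1` particles in `ℝ³` -/

/-- Physical space `ℝ³` with its Euclidean norm and Lebesgue measure. -/
abbrev R3 : Type := EuclideanSpace ℝ (Fin 3)

/-- Configuration space `ℝ^{3N}` of `N` particles, with Lebesgue measure. -/
abbrev Config (N : ℕ) : Type := Fin N → R3

/-- The unit coordinate vector of `ℝ^{3N}` for the `i`-th coordinate of the `k`-th particle. -/
def dir {N : ℕ} (k : Fin N) (i : Fin 3) : Config N :=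
  Pi.single k (EuclideanSpace.single i (1 : ℝ))

/-- The weak partial derivative of `ψ` in the `i`-th coordinate of the `k`-th particle. -/
def partialD {N : ℕ} (ψ : Config N → ℂ) (k : Fin N) (i : Fin 3) : Config N → ℂ :=
  weakDeriv ψ (dir k i)

/-- `ψ` changes by the sign of the permutation when the particles are permuted. -/
def Antisymmetric {N : ℕ} (ψ : Config N → ℂ) : Prop :=
  ∀ σ : Equiv.Perm (Fin N), ∀ᵐ x : Config N,
    ψ (fun k => x (σ k)) = ((Equiv.Perm.sign σ : ℤ) : ℂ) * ψ x

/-- `W_N`: antisymmetric `H¹` functions on `ℝ^{3N}` with `L²`-norm one. -/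
def W (N : ℕ) : Set (Config N → ℂ) :=
  {ψ | MemH1 ψ ∧ Antisymmetric ψ ∧ eLpNorm ψ 2 volume = 1}

/-- The particle density `ρ_ψ(x) = N ∫ |ψ(x, x₂, …, x_N)|² dx₂ … dx_N`, `N = n + 1`. -/
def density {n : ℕ} (ψ : Config (n + 1) → ℂ) (x : R3) : ℝ :=
  ((n + 1 : ℕ) : ℝ) * ∫ y : Config n, ‖ψ (Fin.cons x y)‖ ^ 2

/-- The paramagnetic current density
`j_ψ(x) = N Im ∫ ψ*(x, x₂, …, x_N) ∇ₓ ψ(x, x₂, …, x_N) dx₂ … dx_N`, `N = n + 1`. -/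
def current {n : ℕ} (ψ : Config (n + 1) → ℂ) (x : R3) : R3 :=
  WithLp.toLp 2 fun i : Fin 3 => ((n + 1 : ℕ) : ℝ) *
    (∫ y : Config n, star (ψ (Fin.cons x y)) * partialD ψ 0 i (Fin.cons x y)).im

/-- `ψ ↦ (ρ, j)`, as an equality of (classes of) integrable functions. -/
def Yields {n : ℕ} (ψ : Config (n + 1) → ℂ) (ρ : R3 → ℝ) (j : R3 → R3) : Prop :=
  (∀ᵐ x, density ψ x = ρ x) ∧ (∀ᵐ x, current ψ x = j x)

/-- The set `Y_N` of density pairs. In the last condition the integrand is a quotient in `[0, ∞]`,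
with `0 / 0 = 0` and `a / 0 = ∞` for `a ≠ 0`. -/
def Y (N : ℕ) : Set ((R3 → ℝ) × (R3 → R3)) :=
  {p | (∀ᵐ x, 0 ≤ p.1 x) ∧
    Integrable p.1 volume ∧ ∫ x, p.1 x = N ∧
    MemH1 (fun x => Real.sqrt (p.1 x)) ∧
    (∀ i : Fin 3, Integrable (fun x => p.2 x i) volume) ∧
    ∫⁻ x, ‖p.2 x‖ₑ ^ 2 / ENNReal.ofReal (p.1 x) < ⊤}

/-- The pair comes from at least one wave function in `W_N`, `N = n + 1`. -/
def IsNRepresentable (n : ℕ) (ρ : R3 → ℝ) (j : R3 → R3) : Prop :=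
  ∃ ψ ∈ W (n + 1), Yields ψ ρ j

/-! ### Energies and density functionals -/

/-- The kinetic energy `(ψ, K ψ) = ∑ₖ ∫ |∇ₖ ψ|²`. -/
def kinetic {N : ℕ} (ψ : Config N → ℂ) : ℝ≥0∞ :=
  ∑ k : Fin N, ∑ i : Fin 3, ∫⁻ x, ‖partialD ψ k i x‖ₑ ^ 2

/-- The Coulomb repulsion `∑_{k < l} ∫ |ψ|² |xₖ - xₗ|⁻¹`. -/
def coulomb {N : ℕ} (ψ : Config N → ℂ) : ℝ≥0∞ :=
  ∑ k : Fin N, ∑ l ∈ Finset.Ioi k, ∫⁻ x : Config N, ‖ψ x‖ₑ ^ 2 / ‖x k - x l‖ₑ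

/-- `(ψ, H₀ ψ)`: kinetic energy plus Coulomb repulsion. -/
def energyH0 {N : ℕ} (ψ : Config N → ℂ) : ℝ≥0∞ :=
  kinetic ψ + coulomb ψ

/-- `Q(ρ, j) = inf {(ψ, H₀ ψ) | ψ ∈ W_N, ψ ↦ (ρ, j)}`, `N = n + 1`. -/
def Q (n : ℕ) (ρ : R3 → ℝ) (j : R3 → R3) : ℝ≥0∞ :=
  sInf {e | ∃ ψ ∈ W (n + 1), Yields ψ ρ j ∧ e = energyH0 ψ}

/-- `Q'(ρ, j) = inf {(ψ, K ψ) | ψ ∈ W_N, ψ ↦ (ρ, j)}`, `N = n + 1`. -/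
def Q' (n : ℕ) (ρ : R3 → ℝ) (j : R3 → R3) : ℝ≥0∞ :=
  sInf {e | ∃ ψ ∈ W (n + 1), Yields ψ ρ j ∧ e = kinetic ψ}

end

end CDFT

/-! This is the direct method of the calculus of variations. Along a minimizing sequence the kinetic
energy is bounded, so a subsequence of the wave functions and of their gradients converges weakly in
`L²`. Weak convergence alone could lose mass at infinity and would not preserve the quadratic
quantities `ρ` and `j`. The constraint itself prevents the loss: by antisymmetry all one-particle
marginals agree, so the mass outside a ball of radius `R` is at most the integral of the fixed
density `ρ` over `|x| > R`.

Tightness and the translation estimate coming from the gradients turn weak into strong `L²`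
convergence (`tendsto_of_weak_of_tight`). Norm, antisymmetry and density then survive in the limit.
The current survives because it pairs a strongly convergent factor with a weakly convergent one;
integrals over the cylinders `x 0 ∈ A` identify the marginals. All this is
`exists_subseq_tendsto_of_yields`.

Kinetic energy is weakly lower semicontinuous, and Coulomb repulsion is so under pointwise
convergence by Fatou. `exists_minimizer` treats both functionals at once, with potential `V =
coulomb` or `V = 0`. -/

namespace CDFT

open Filter Topology

/-! ### Calculus of weak derivatives -/

section WeakDerivatives

variable {E F : Type*} [NormedAddCommGroup E] [NormedSpace ℝ E] [MeasureSpace E]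
  [NormedAddCommGroup F] [NormedSpace ℝ F]

theorem HasWeakDeriv.congr {f f' : E → F} {v : E} {g g' : E → F} (h : HasWeakDeriv f v g)
    (hf : f =ᵐ[volume] f') (hg : g =ᵐ[volume] g') : HasWeakDeriv f' v g' := by
  refine ⟨h.1.congr hf, h.2.1.congr hg, fun φ hφ hc => ?_⟩
  have h1 : ∫ x, (fderiv ℝ φ x v) • f' x = ∫ x, (fderiv ℝ φ x v) • f x :=
    integral_congr_ae (hf.mono fun x hx => by simp only [hx])
  have h2 : ∫ x, φ x • g' x = ∫ x, φ x • g x :=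
    integral_congr_ae (hg.mono fun x hx => by simp only [hx])
  rw [h1, h2, h.2.2 φ hφ hc]

theorem hasWeakDeriv_weakDeriv {f : E → F} {v : E} {g : E → F} (h : HasWeakDeriv f v g) :
    HasWeakDeriv f v (weakDeriv f v) := by
  have hex : ∃ g : E → F, HasWeakDeriv f v g := ⟨g, h⟩
  rw [weakDeriv, dif_pos hex]
  exact hex.choose_spec

theorem HasCompactSupport.fderiv_apply_real {E G : Type*} [NormedAddCommGroup E]
    [NormedSpace ℝ E] [NormedAddCommGroup G] [NormedSpace ℝ G] {φ : E → G} (hc : HasCompactSupport φ) (v : E) :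
    HasCompactSupport fun x => fderiv ℝ φ x v :=
  (hc.fderiv ℝ).comp_left (g := fun L : E →L[ℝ] G => L v) rfl

theorem HasWeakDeriv.smul_dir {f : E → F} {v : E} {g : E → F} (h : HasWeakDeriv f v g) (c : ℝ) :
    HasWeakDeriv f (c • v) (fun x => c • g x) := by
  refine ⟨h.1, h.2.1.smul c, fun φ hφ hc => ?_⟩
  simp only [map_smul, smul_assoc, smul_comm (φ _) c]
  rw [integral_smul, integral_smul, h.2.2 φ hφ hc, smul_neg]

theorem HasWeakDeriv.zero_dir {f : E → F} (hf : LocallyIntegrable f volume) :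
    HasWeakDeriv f 0 (fun _ => 0) :=
  ⟨hf, locallyIntegrable_zero, fun φ _ _ => by simp⟩

variable [BorelSpace E]

theorem HasWeakDeriv.add_dir {f : E → F} {v w : E} {g k : E → F} (h : HasWeakDeriv f v g)
    (h' : HasWeakDeriv f w k) : HasWeakDeriv f (v + w) (fun x => g x + k x) := by
  refine ⟨h.1, h.2.1.add h'.2.1, fun φ hφ hc => ?_⟩
  have hi := fun v => h.1.integrable_smul_left_of_hasCompactSupport
    ((hφ.continuous_fderiv (by simp)).clm_apply continuous_const)
    (HasCompactSupport.fderiv_apply_real hc v)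
  simp only [map_add, add_smul, smul_add]
  rw [integral_add (hi v) (hi w), integral_add
    (h.2.1.integrable_smul_left_of_hasCompactSupport hφ.continuous hc)
    (h'.2.1.integrable_smul_left_of_hasCompactSupport hφ.continuous hc),
    h.2.2 φ hφ hc, h'.2.2 φ hφ hc, neg_add]

theorem HasWeakDeriv.sum_dir {ι : Type*} {f : E → F} (hf : LocallyIntegrable f volume)
    (s : Finset ι) {v : ι → E} {g : ι → E → F} (h : ∀ i ∈ s, HasWeakDeriv f (v i) (g i)) :
    HasWeakDeriv f (∑ i ∈ s, v i) (fun x => ∑ i ∈ s, g i x) := by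
  classical
  induction s using Finset.induction_on with
  | empty => simpa using HasWeakDeriv.zero_dir hf
  | insert a s ha ih =>
    simp only [Finset.sum_insert ha]
    exact (h a (by simp)).add_dir (ih fun i hi => h i (Finset.mem_insert_of_mem hi))

theorem HasWeakDeriv.ae_unique [FiniteDimensional ℝ E] [CompleteSpace F] {f : E → F} {v : E}
    {g g' : E → F} (h : HasWeakDeriv f v g) (h' : HasWeakDeriv f v g') : g =ᵐ[volume] g' := by
  refine ae_eq_of_integral_contDiff_smul_eq h.2.1 h'.2.1 fun φ hφ hc => ?_
  rw [← neg_inj, ← h.2.2 φ hφ hc, ← h'.2.2 φ hφ hc]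

/-- Since `weakDeriv` is an arbitrary choice, this is what identifies it with a derivative obtained
as a weak limit. -/
theorem weakDeriv_ae_eq [FiniteDimensional ℝ E] [CompleteSpace F] {f : E → F} {v : E}
    {g : E → F} (h : HasWeakDeriv f v g) : weakDeriv f v =ᵐ[volume] g :=
  (hasWeakDeriv_weakDeriv h).ae_unique h

end WeakDerivatives

theorem enorm_integral_mul_le_eLpNorm {α : Type*} [MeasureSpace α] {f g : α → ℂ}
    (hf : MemLp f 2 volume) (hg : MemLp g 2 volume) :
    ‖∫ x, f x * g x‖ₑ ≤ eLpNorm f 2 volume * eLpNorm g 2 volume := by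
  refine (enorm_integral_le_lintegral_enorm _).trans ?_
  rw [← eLpNorm_one_eq_lintegral_enorm]
  change eLpNorm (f • g) 1 volume ≤ _
  exact eLpNorm_smul_le_mul_eLpNorm hg.1 hf.1

/-! ### Translation estimate in `L²` -/

section Translation

variable {E : Type*} [NormedAddCommGroup E] [NormedSpace ℝ E] [MeasureSpace E] [BorelSpace E]

/-- The defining identity of a weak derivative also holds for complex test functions. -/
theorem HasWeakDeriv.integral_mul_complex {f : E → ℂ} {v : E} {g : E → ℂ}
    (h : HasWeakDeriv f v g) {φ : E → ℂ} (hφ : ContDiff ℝ ∞ φ) (hc : HasCompactSupport φ) :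
    ∫ x, fderiv ℝ φ x v * f x = - ∫ x, φ x * g x := by
  have hre : ContDiff ℝ ∞ fun x => (φ x).re := Complex.reCLM.contDiff.comp hφ
  have him : ContDiff ℝ ∞ fun x => (φ x).im := Complex.imCLM.contDiff.comp hφ
  have hrec : HasCompactSupport fun x => (φ x).re := hc.comp_left (g := Complex.re) rfl
  have himc : HasCompactSupport fun x => (φ x).im := hc.comp_left (g := Complex.im) rfl
  have hdre : ∀ x, fderiv ℝ (fun x => (φ x).re) x v = (fderiv ℝ φ x v).re := fun x => by
    have := (Complex.reCLM.hasFDerivAt.comp x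
      (hφ.differentiable (by simp) x).hasFDerivAt).fderiv
    exact congrArg (fun L => L v) this
  have hdim : ∀ x, fderiv ℝ (fun x => (φ x).im) x v = (fderiv ℝ φ x v).im := fun x => by
    have := (Complex.imCLM.hasFDerivAt.comp x
      (hφ.differentiable (by simp) x).hasFDerivAt).fderiv
    exact congrArg (fun L => L v) this
  have h1 := h.2.2 _ hre hrec
  have h2 := h.2.2 _ him himc
  have i1 := h.2.1.integrable_smul_left_of_hasCompactSupport hre.continuous hrec
  have i2 := h.2.1.integrable_smul_left_of_hasCompactSupport him.continuous himc
  have j1 := h.1.integrable_smul_left_of_hasCompactSupport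
    ((hre.continuous_fderiv (by simp)).clm_apply continuous_const)
    (HasCompactSupport.fderiv_apply_real hrec v)
  have j2 := h.1.integrable_smul_left_of_hasCompactSupport
    ((him.continuous_fderiv (by simp)).clm_apply continuous_const)
    (HasCompactSupport.fderiv_apply_real himc v)
  have split : ∀ z w : ℂ, z * w = z.re • w + Complex.I * (z.im • w) := fun z w => by
    conv_lhs => rw [← Complex.re_add_im z]
    simp only [Complex.real_smul]
    ring
  have e1 : (fun x => fderiv ℝ φ x v * f x) = fun x => fderiv ℝ (fun x => (φ x).re) x v • f x +
      Complex.I * (fderiv ℝ (fun x => (φ x).im) x v • f x) := by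
    funext x
    rw [split, hdre, hdim]
  have e2 : (fun x => φ x * g x) = fun x => (φ x).re • g x + Complex.I * ((φ x).im • g x) :=
    funext fun x => split _ _
  rw [e1, e2, integral_add j1 (j2.const_mul _), integral_add i1 (i2.const_mul _),
    integral_const_mul, integral_const_mul, h1, h2]
  ring

variable [FiniteDimensional ℝ E] [(volume : Measure E).IsAddHaarMeasure]

/-- The function `x ↦ φ (t • v - x)` is itself a test function, and the reflection gives its
derivative along `v` a minus sign that cancels the one in the definition of a weak derivative. -/
theorem HasWeakDeriv.hasDerivAt_convolution {f : E → ℂ} {v : E} {g : E → ℂ}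
    (h : HasWeakDeriv f v g) {φ : E → ℂ} (hφ : ContDiff ℝ ∞ φ) (hc : HasCompactSupport φ)
    (t : ℝ) :
    HasDerivAt (fun s : ℝ => ∫ x, f x * φ (s • v - x)) (∫ x, φ (t • v - x) * g x) t := by
  have key := hc.hasFDerivAt_convolution_right (ContinuousLinearMap.mul ℝ ℂ) h.1
    (hφ.of_le (by simp)) (t • v)
  have hline : HasDerivAt (fun s : ℝ => s • v) v t := by
    simpa using (hasDerivAt_id t).smul_const v
  have hd := key.comp_hasDerivAt t hline
  refine hd.congr_deriv ?_
  rw [convolution_precompR_apply _ h.1 (hc.fderiv ℝ) (hφ.continuous_fderiv (by simp))]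
  have hχ : ContDiff ℝ ∞ fun x => φ (t • v - x) := hφ.comp (contDiff_const.sub contDiff_id)
  have hχc : HasCompactSupport fun x => φ (t • v - x) :=
    hc.comp_homeomorph (Homeomorph.subLeft (t • v))
  have hw := h.integral_mul_complex hχ hχc
  have hder : ∀ x, fderiv ℝ (fun x => φ (t • v - x)) x v = - fderiv ℝ φ (t • v - x) v :=
    fun x => by
      have h1 := (hφ.differentiable (by simp) (t • v - x)).hasFDerivAt.comp x
        ((hasFDerivAt_id x).const_sub (t • v))
      have := congrArg (fun L => L v) h1.fderiv
      simpa [Function.comp_def] using this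
  simp only [hder, neg_mul, integral_neg, neg_inj] at hw
  rw [← hw]
  exact integral_congr_ae (.of_forall fun x => by simp [mul_comm])

/-- Translating an `L²` function by `v` moves it by at most the `L²` norm of its weak derivative
in the direction `v`. -/
theorem HasWeakDeriv.eLpNorm_translate_sub_le {f : E → ℂ} {v : E} {g : E → ℂ}
    (h : HasWeakDeriv f v g) (hf : MemLp f 2 volume) (hg : MemLp g 2 volume) :
    eLpNorm (fun x => f (x + v) - f x) 2 volume ≤ eLpNorm g 2 volume := by
  have hmp : MeasurePreserving (fun x : E => x + v) := measurePreserving_add_right volume v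
  have hD : MemLp (fun x => f (x + v) - f x) 2 volume := (hf.comp_measurePreserving hmp).sub hf
  -- the bound tested against smooth functions
  have hsmooth : ∀ φ : E → ℂ, ContDiff ℝ ∞ φ → HasCompactSupport φ →
      ‖∫ x, φ x * (f (x + v) - f x)‖ₑ ≤ eLpNorm φ 2 volume * eLpNorm g 2 volume := by
    intro φ hφ hc
    -- After reflection, `χ (t • v - x) = φ (x - t • v)`: the convolution at `t • v` pairs `φ` with
    -- the translate of `f` by `t • v`. The mean value inequality on `[0, 1]` then bounds the
    -- difference of the endpoints.
    set χ : E → ℂ := fun x => φ (-x) with hχdef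
    have hχ : ContDiff ℝ ∞ χ := hφ.comp contDiff_neg
    have hχc : HasCompactSupport χ := hc.comp_homeomorph (Homeomorph.neg E)
    have hφL : MemLp φ 2 volume := hφ.continuous.memLp_of_hasCompactSupport hc
    have hχL : ∀ y, MemLp (fun x => χ (y - x)) 2 volume := fun y =>
      (hχ.continuous.memLp_of_hasCompactSupport hχc).comp_measurePreserving
        (Measure.measurePreserving_sub_left volume y)
    have hχn : ∀ y, eLpNorm (fun x => χ (y - x)) 2 volume = eLpNorm φ 2 volume := fun y => by
      have : (fun x => χ (y - x)) = φ ∘ fun x => x - y := by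
        funext x; simp [hχdef]
      rw [this, eLpNorm_comp_measurePreserving hφL.1 (measurePreserving_sub_right volume y)]
    have hbd : ∀ t : ℝ, ‖∫ x, χ (t • v - x) * g x‖ ≤
        (eLpNorm φ 2 volume * eLpNorm g 2 volume).toReal := fun t => by
      rw [← toReal_enorm]
      refine ENNReal.toReal_mono (ENNReal.mul_ne_top hφL.2.ne hg.2.ne) ?_
      rw [← hχn (t • v)]
      exact enorm_integral_mul_le_eLpNorm (hχL _) hg
    have hmv := norm_image_sub_le_of_norm_deriv_le_segment_01'
      (fun t _ => (h.hasDerivAt_convolution hχ hχc t).hasDerivWithinAt) (fun t _ => hbd t)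
    have e : ∫ x, φ x * (f (x + v) - f x) =
        (∫ x, f x * χ ((1 : ℝ) • v - x)) - ∫ x, f x * χ ((0 : ℝ) • v - x) := by
      have e1 : ∫ x, f x * χ ((1 : ℝ) • v - x) = ∫ x, f (x + v) * φ x := by
        rw [← integral_add_right_eq_self _ v]
        simp [hχdef]
      have e0 : ∫ x, f x * χ ((0 : ℝ) • v - x) = ∫ x, f x * φ x := by simp [hχdef]
      rw [e1, e0, ← integral_sub]
      · exact integral_congr_ae (.of_forall fun x => by simp only; ring)
      · exact (hf.comp_measurePreserving hmp).integrable_mul hφL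
      · exact hf.integrable_mul hφL
    rw [e, ← ofReal_norm, ← ENNReal.ofReal_toReal (ENNReal.mul_ne_top hφL.2.ne hg.2.ne)]
    exact ENNReal.ofReal_le_ofReal hmv
  -- extend to all test functions by density
  set D : E → ℂ := fun x => f (x + v) - f x with hDdef
  set d := eLpNorm D 2 volume with hd
  have hdtop : d ≠ ⊤ := hD.2.ne
  -- Duality: pairing `D` with its own conjugate gives `d * d`. Approximating the conjugate by
  -- smooth `φ` yields `d * d ≤ d * ‖g‖`, and one factor `d` cancels.
  have hself : ‖∫ x, star (D x) * D x‖ₑ = d * d := by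
    have e1 : ∫ x, star (D x) * D x = ((∫ x, ‖D x‖ ^ 2 : ℝ) : ℂ) := by
      rw [← integral_complex_ofReal]
      exact integral_congr_ae (.of_forall fun x => by
        simp [Complex.conj_mul'])
    have e2 : ∫ x, ‖D x‖ ^ 2 = d.toReal ^ 2 := by
      have := hD.eLpNorm_eq_integral_rpow_norm (by norm_num) (by norm_num)
      rw [hd, this]
      rw [ENNReal.toReal_ofReal (by positivity)]
      simp only [ENNReal.toReal_ofNat, Real.rpow_ofNat]
      rw [← Real.rpow_natCast, ← Real.rpow_mul (integral_nonneg fun _ => by positivity)]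
      norm_num
    rw [e1, e2, ← ofReal_norm, Complex.norm_real, Real.norm_of_nonneg (by positivity), sq,
      ENNReal.ofReal_mul ENNReal.toReal_nonneg, ENNReal.ofReal_toReal hdtop]
  have hstar : MemLp (fun x => star (D x)) 2 volume := hD.star
  have hε : ∀ ε : ℝ, 0 < ε → d * d ≤ (d + ENNReal.ofReal ε) * eLpNorm g 2 volume +
      ENNReal.ofReal ε * d := by
    intro ε hε
    obtain ⟨φ, hc, hφ, hle⟩ := hstar.exist_eLpNorm_sub_le (by norm_num) (by norm_num) hε
    have hφL : MemLp φ 2 volume := hφ.continuous.memLp_of_hasCompactSupport hc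
    have hsn : eLpNorm (fun x => star (D x)) 2 volume = d :=
      eLpNorm_congr_norm_ae (.of_forall fun x => by simp)
    have hφn : eLpNorm φ 2 volume ≤ d + ENNReal.ofReal ε := by
      have : φ = (fun x => star (D x)) - ((fun x => star (D x)) - φ) := by simp
      rw [this]
      refine (eLpNorm_sub_le hstar.1 (hstar.sub hφL).1 (by norm_num)).trans ?_
      rw [hsn]
      gcongr
    have hsplit : ∫ x, star (D x) * D x = (∫ x, φ x * D x) +
        ∫ x, ((fun x => star (D x)) - φ) x * D x := by
      refine Eq.trans ?_ (integral_add (hφL.integrable_mul hD) ((hstar.sub hφL).integrable_mul hD))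
      exact integral_congr_ae (.of_forall fun x => by simp only [Pi.sub_apply]; ring)
    rw [← hself, hsplit]
    refine (enorm_add_le _ _).trans (add_le_add ?_ ?_)
    · exact (hsmooth φ hφ hc).trans (by gcongr)
    · exact (enorm_integral_mul_le_eLpNorm (hstar.sub hφL) hD).trans (by gcongr)
  have hlim : d * d ≤ d * eLpNorm g 2 volume := by
    have ht : Tendsto (fun ε : ℝ => (d + ENNReal.ofReal ε) * eLpNorm g 2 volume +
        ENNReal.ofReal ε * d) (𝓝[>] 0) (𝓝 ((d + ENNReal.ofReal 0) * eLpNorm g 2 volume +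
        ENNReal.ofReal 0 * d)) := by
      have h0 : Tendsto (fun ε : ℝ => ENNReal.ofReal ε) (𝓝[>] 0) (𝓝 (ENNReal.ofReal 0)) :=
        (ENNReal.continuous_ofReal.tendsto 0).mono_left nhdsWithin_le_nhds
      exact (ENNReal.Tendsto.mul_const (tendsto_const_nhds.add h0) (.inr hg.2.ne)).add
        (ENNReal.Tendsto.mul_const h0 (.inr hdtop))
    have := ge_of_tendsto ht (eventually_mem_nhdsWithin.mono fun ε hε' => hε ε hε')
    simpa using this
  rcases eq_or_ne d 0 with h0 | h0
  · rw [h0]; exact zero_le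
  · exact (ENNReal.mul_le_mul_iff_right h0 hdtop).1 hlim

end Translation

/-! ### Local compactness of Rellich–Kolmogorov type -/

section LocalCompactness

theorem eLpNorm_two_sq_eq_lintegral {α G : Type*} [MeasurableSpace α] [NormedAddCommGroup G]
    (f : α → G) (μ : Measure α) : eLpNorm f 2 μ ^ 2 = ∫⁻ x, ‖f x‖ₑ ^ 2 ∂μ := by
  have := eLpNorm_nnreal_pow_eq_lintegral (f := f) (μ := μ) (p := 2) (by norm_num)
  simpa using this

variable {E : Type*} [NormedAddCommGroup E] [MeasureSpace E] [BorelSpace E]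

/-- For a probability measure the `L¹` norm in `h` is at most the `L²` norm; Tonelli then exchanges
the integrals in `x` and `h`. -/
theorem eLpNorm_sub_integral_translate_le [SecondCountableTopology E]
    [SFinite (volume : Measure E)] {ν : Measure E} [IsProbabilityMeasure ν]
    {f : E → ℂ} (hf : StronglyMeasurable f) (hi : ∀ x, Integrable (fun h => f (x + h)) ν)
    {δ : ℝ≥0∞} (hδ : ∀ᵐ h ∂ν, eLpNorm (fun x => f (x + h) - f x) 2 volume ≤ δ) :
    eLpNorm (fun x => f x - ∫ h, f (x + h) ∂ν) 2 volume ≤ δ := by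
  have hm : StronglyMeasurable fun p : E × E => f (p.1 + p.2) - f p.1 :=
    (hf.comp_measurable (measurable_fst.add measurable_snd)).sub (hf.comp_measurable measurable_fst)
  have hsq : eLpNorm (fun x => f x - ∫ h, f (x + h) ∂ν) 2 volume ^ 2 ≤ δ ^ 2 := by
    rw [eLpNorm_two_sq_eq_lintegral]
    calc ∫⁻ x, ‖f x - ∫ h, f (x + h) ∂ν‖ₑ ^ 2
        ≤ ∫⁻ x, ∫⁻ h, ‖f (x + h) - f x‖ₑ ^ 2 ∂ν := by
          refine lintegral_mono fun x => ?_
          have e : f x - ∫ h, f (x + h) ∂ν = - ∫ h, (f (x + h) - f x) ∂ν := by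
            rw [integral_sub (hi x) (integrable_const _)]
            simp
          rw [e, enorm_neg, ← eLpNorm_two_sq_eq_lintegral]
          gcongr
          refine (enorm_integral_le_lintegral_enorm _).trans ?_
          rw [← eLpNorm_one_eq_lintegral_enorm]
          exact eLpNorm_le_eLpNorm_of_exponent_le (by norm_num)
            ((hi x).sub (integrable_const _)).1
      _ = ∫⁻ h, ∫⁻ x, ‖f (x + h) - f x‖ₑ ^ 2 ∂volume ∂ν :=
          lintegral_lintegral_swap (hm.enorm.pow_const 2).aemeasurable
      _ ≤ ∫⁻ _, δ ^ 2 ∂ν := by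
          refine lintegral_mono_ae (hδ.mono fun h hh => ?_)
          rw [← eLpNorm_two_sq_eq_lintegral]
          gcongr
      _ = δ ^ 2 := by simp
  exact (ENNReal.pow_le_pow_left_iff two_ne_zero).1 hsq

variable [NormedSpace ℝ E] [FiniteDimensional ℝ E] [(volume : Measure E).IsAddHaarMeasure]

open scoped InnerProductSpace in
/-- A bounded sequence in `L²` which is uniformly continuous under translations and converges
weakly to zero converges strongly to zero on bounded sets. -/
theorem tendsto_eLpNorm_indicator_closedBall {f : ℕ → Lp ℂ 2 (volume : Measure E)} {C : ℝ≥0∞}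
    (hC : C ≠ ⊤) {M : ℝ} (hM : ∀ m, ‖f m‖ ≤ M)
    (htr : ∀ m h, eLpNorm (fun x => f m (x + h) - f m x) 2 volume ≤ ENNReal.ofReal ‖h‖ * C)
    (hweak : ∀ u : Lp ℂ 2 (volume : Measure E), Tendsto (fun m => ⟪u, f m⟫_ℂ) atTop (𝓝 0))
    (R : ℝ) :
    Tendsto (fun m => eLpNorm ((Metric.closedBall 0 R).indicator (f m)) 2 volume)
      atTop (𝓝 0) := by
  have : ProperSpace E := FiniteDimensional.proper ℝ E
  rw [ENNReal.tendsto_nhds_zero]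
  intro ε hε
  -- The averaging radius depends on `ε` and `C` only, so replacing `f m` by its mean over balls of
  -- radius `r` costs at most `ε / 2` uniformly in `m`.
  obtain ⟨r, hr, hrε⟩ : ∃ r : ℝ, 0 < r ∧ ENNReal.ofReal r * C ≤ ε / 2 := by
    have h0 : Tendsto (fun r : ℝ => ENNReal.ofReal r * C) (𝓝[>] 0) (𝓝 (ENNReal.ofReal 0 * C)) :=
      ENNReal.Tendsto.mul_const
        ((ENNReal.continuous_ofReal.tendsto 0).mono_left nhdsWithin_le_nhds) (.inr hC)
    rw [ENNReal.ofReal_zero, zero_mul] at h0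
    have h1 := (ENNReal.tendsto_nhds_zero.1 h0 (ε / 2) (by simpa using hε.ne'))
    obtain ⟨r, h2, h3⟩ := (h1.and eventually_mem_nhdsWithin).exists
    exact ⟨r, h3, h2⟩
  set B : Set E := Metric.closedBall 0 r with hB
  have hBm : MeasurableSet B := Metric.isClosed_closedBall.measurableSet
  have hB0 : volume B ≠ 0 := (Metric.measure_closedBall_pos volume 0 hr).ne'
  have hBtop : volume B ≠ ⊤ := measure_closedBall_lt_top.ne
  set ν : Measure E := ProbabilityTheory.cond volume B with hν
  have : IsProbabilityMeasure ν := ProbabilityTheory.cond_isProbabilityMeasure_of_finite hB0 hBtop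
  set A : ℕ → E → ℂ := fun m x => ∫ h, f m (x + h) ∂ν with hA
  have hball : ∀ x : E, (fun h => x + h) ⁻¹' Metric.closedBall x r = B := fun x => by
    ext h; simp [hB]
  have hint : ∀ m x, Integrable (fun h => f m (x + h)) ν := fun m x => by
    have h1 : LocallyIntegrable (f m) volume := (Lp.memLp (f m)).locallyIntegrable (by norm_num)
    have h2 := h1.integrableOn_isCompact (isCompact_closedBall x r)
    rw [← (measurePreserving_add_left volume x).integrableOn_comp_preimage
      (measurableEmbedding_addLeft x), hball] at h2
    rw [hν, ProbabilityTheory.cond]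
    exact Integrable.smul_measure h2 (ENNReal.inv_ne_top.2 hB0)
  have hvol : ∀ x : E, volume (Metric.closedBall x r) = volume B := fun x =>
    Measure.addHaar_closedBall_center volume x r
  have hxtop : ∀ x : E, volume (Metric.closedBall x r) ≠ ⊤ := fun x => by rw [hvol]; exact hBtop
  -- A ball average is an inner product with a fixed indicator. Weak convergence therefore makes the
  -- averages tend to zero pointwise, and Cauchy–Schwarz bounds them uniformly, so dominated
  -- convergence applies on the bounded set.
  have hAeq : ∀ m x, A m x = ((volume B)⁻¹).toReal •
      ⟪indicatorConstLp 2 (μ := volume) (Metric.isClosed_closedBall.measurableSet) (hxtop x)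
        (1 : ℂ), f m⟫_ℂ := fun m x => by
    rw [L2.inner_indicatorConstLp_one]
    simp only [hA, hν, ProbabilityTheory.cond, integral_smul_measure]
    congr 1
    rw [← hball x]
    exact (measurePreserving_add_left volume x).setIntegral_preimage_emb
      (measurableEmbedding_addLeft x) _ _
  have hAlim : ∀ x, Tendsto (fun m => A m x) atTop (𝓝 0) := fun x => by
    simp only [hAeq]
    simpa using (hweak (indicatorConstLp 2 (μ := volume) Metric.isClosed_closedBall.measurableSet
      (hxtop x) (1 : ℂ))).const_smul ((volume B)⁻¹).toReal
  set K : ℝ := ((volume B)⁻¹).toReal * ((volume B).toReal ^ (1 / 2 : ℝ) * M) with hK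
  have hAbd : ∀ m x, ‖A m x‖ ≤ K := fun m x => by
    rw [hAeq, norm_smul, Real.norm_of_nonneg ENNReal.toReal_nonneg]
    refine mul_le_mul_of_nonneg_left ?_ ENNReal.toReal_nonneg
    refine (norm_inner_le_norm _ _).trans ?_
    rw [norm_indicatorConstLp (by norm_num) (by norm_num)]
    simp only [measureReal_def, hvol, norm_one, one_mul, ENNReal.toReal_ofNat]
    gcongr
    exact hM m
  have hAm : ∀ m, StronglyMeasurable (A m) := fun m =>
    StronglyMeasurable.integral_prod_right (f := fun x h => f m (x + h))
      ((Lp.stronglyMeasurable (f m)).comp_measurable (measurable_fst.add measurable_snd))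
  set S : Set E := Metric.closedBall 0 R
  have hSm : MeasurableSet S := Metric.isClosed_closedBall.measurableSet
  have hSA : Tendsto (fun m => eLpNorm (S.indicator (A m)) 2 volume) atTop (𝓝 0) := by
    have h2 : Tendsto (fun m => ∫⁻ x in S, ‖A m x‖ₑ ^ 2) atTop (𝓝 (∫⁻ x in S, 0)) := by
      refine tendsto_lintegral_of_dominated_convergence (fun _ => ENNReal.ofReal K ^ 2)
        (fun m => ((hAm m).enorm.pow_const 2)) (fun m => .of_forall fun x => ?_) ?_ ?_
      · change ‖A m x‖ₑ ^ 2 ≤ ENNReal.ofReal K ^ 2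
        rw [← ofReal_norm]
        gcongr
        exact hAbd m x
      · rw [setLIntegral_const]
        exact ENNReal.mul_ne_top (by simp) measure_closedBall_lt_top.ne
      · refine .of_forall fun x => ?_
        simpa [Function.comp_def] using ((ENNReal.continuous_pow 2).tendsto _).comp (hAlim x).enorm
    rw [lintegral_zero] at h2
    have h3 := ((ENNReal.continuous_rpow_const (y := (1 / 2 : ℝ))).tendsto 0).comp h2
    rw [ENNReal.zero_rpow_of_pos (by norm_num)] at h3
    refine h3.congr fun m => ?_
    rw [Function.comp_apply, ← eLpNorm_two_sq_eq_lintegral,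
      eLpNorm_indicator_eq_eLpNorm_restrict hSm, ← ENNReal.rpow_natCast, ← ENNReal.rpow_mul]
    norm_num
  have hev := ENNReal.tendsto_nhds_zero.1 hSA (ε / 2) (by simpa using hε.ne')
  filter_upwards [hev] with m hm
  have hdiff : eLpNorm (fun x => f m x - A m x) 2 volume ≤ ε / 2 := by
    refine eLpNorm_sub_integral_translate_le (Lp.stronglyMeasurable (f m)) (hint m) ?_
    have hmem : ∀ᵐ h ∂ν, h ∈ B := ProbabilityTheory.ae_cond_mem hBm
    filter_upwards [hmem] with h hh
    refine (htr m h).trans (le_trans ?_ hrε)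
    gcongr
    simpa [hB] using hh
  have e : S.indicator (f m) = S.indicator (fun x => f m x - A m x) + S.indicator (A m) := by
    rw [← Set.indicator_add']
    congr 1
    funext x
    simp
  rw [e]
  refine (eLpNorm_add_le (((Lp.stronglyMeasurable (f m)).sub (hAm m)).indicator
    hSm).aestronglyMeasurable ((hAm m).indicator hSm).aestronglyMeasurable (by norm_num)).trans ?_
  refine (add_le_add ((eLpNorm_indicator_le _).trans hdiff) hm).trans ?_
  rw [ENNReal.add_halves]

end LocalCompactness

/-! ### Weak convergence in Hilbert space -/

section WeakConvergence

open scoped InnerProductSpace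

variable {H : Type*} [NormedAddCommGroup H] [InnerProductSpace ℂ H]

/-- Bounded sequences in a separable Hilbert space have weakly convergent subsequences. -/
theorem exists_subseq_tendsto_inner [CompleteSpace H] [TopologicalSpace.SeparableSpace H]
    {f : ℕ → H} {M : ℝ} (hM : ∀ m, ‖f m‖ ≤ M) :
    ∃ (g : H) (s : ℕ → ℕ), StrictMono s ∧
      ∀ u : H, Tendsto (fun m => ⟪u, f (s m)⟫_ℂ) atTop (𝓝 ⟪u, g⟫_ℂ) := by
  -- Sequential Banach–Alaoglu in the dual, carried over by the Riesz isometry; conjugation moves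
  -- the sequence to the second slot.
  obtain ⟨L, -, s, hs, hL⟩ := WeakDual.isSeqCompact_closedBall ℂ H 0 M
    (x := fun m => StrongDual.toWeakDual (InnerProductSpace.toDual ℂ H (f m)))
    (fun m => by simpa using hM m)
  refine ⟨(InnerProductSpace.toDual ℂ H).symm (WeakDual.toStrongDual L), s, hs, fun u => ?_⟩
  have h1 := ((WeakDual.eval_continuous u).tendsto L).comp hL
  have h2 := (Complex.continuous_conj.tendsto _).comp h1
  have e1 : ∀ m, (starRingEnd ℂ) ((StrongDual.toWeakDual (InnerProductSpace.toDual ℂ H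
      (f (s m)))) u) = ⟪u, f (s m)⟫_ℂ := fun m => inner_conj_symm _ _
  have e2 : (starRingEnd ℂ) (L u) =
      ⟪u, (InnerProductSpace.toDual ℂ H).symm (WeakDual.toStrongDual L)⟫_ℂ := by
    rw [← inner_conj_symm, InnerProductSpace.toDual_symm_apply]
    rfl
  rw [← e2]
  exact h2.congr e1

/-- The inner product of a strongly and a weakly convergent bounded sequence converges. -/
theorem tendsto_inner_of_tendsto_of_weak {f g : ℕ → H} {f₀ g₀ : H} {M : ℝ}
    (hf : Tendsto f atTop (𝓝 f₀)) (hM : ∀ m, ‖g m‖ ≤ M)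
    (hg : ∀ u : H, Tendsto (fun m => ⟪u, g m⟫_ℂ) atTop (𝓝 ⟪u, g₀⟫_ℂ)) :
    Tendsto (fun m => ⟪f m, g m⟫_ℂ) atTop (𝓝 ⟪f₀, g₀⟫_ℂ) := by
  have h1 : Tendsto (fun m => ⟪f m - f₀, g m⟫_ℂ) atTop (𝓝 0) := by
    refine squeeze_zero_norm (a := fun m => ‖f m - f₀‖ * M) (fun m => ?_) ?_
    · exact (norm_inner_le_norm _ _).trans (mul_le_mul_of_nonneg_left (hM m) (norm_nonneg _))
    · simpa using (tendsto_iff_norm_sub_tendsto_zero.1 hf).mul_const M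
  simpa [inner_sub_left] using h1.add (hg f₀)

/-- Expanding `0 ≤ ‖g₀ - g m‖ ^ 2` bounds `‖g m‖ ^ 2` below by an expression affine in `g m`, which
converges to `‖g₀‖ ^ 2`. -/
theorem enorm_le_liminf_of_weak {g : ℕ → H} {g₀ : H}
    (hg : ∀ u : H, Tendsto (fun m => ⟪u, g m⟫_ℂ) atTop (𝓝 ⟪u, g₀⟫_ℂ)) :
    ‖g₀‖ₑ ^ 2 ≤ liminf (fun m => ‖g m‖ₑ ^ 2) atTop := by
  have h1 : Tendsto (fun m => RCLike.re ⟪g₀, g m⟫_ℂ) atTop (𝓝 (‖g₀‖ ^ 2)) := by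
    rw [← inner_self_eq_norm_sq (𝕜 := ℂ)]
    exact (RCLike.continuous_re.tendsto _).comp (hg g₀)
  have h2 : Tendsto (fun m => ENNReal.ofReal (2 * RCLike.re ⟪g₀, g m⟫_ℂ - ‖g₀‖ ^ 2)) atTop
      (𝓝 (‖g₀‖ₑ ^ 2)) := by
    have e : ‖g₀‖ₑ ^ 2 = ENNReal.ofReal (2 * ‖g₀‖ ^ 2 - ‖g₀‖ ^ 2) := by
      rw [← ofReal_norm, ← ENNReal.ofReal_pow (norm_nonneg _)]
      congr 1
      ring
    rw [e]
    exact (ENNReal.continuous_ofReal.tendsto _).comp ((h1.const_mul 2).sub_const _)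
  rw [← h2.liminf_eq]
  refine liminf_le_liminf (.of_forall fun m => ?_)
  rw [← ofReal_norm, ← ENNReal.ofReal_pow (norm_nonneg _)]
  refine ENNReal.ofReal_le_ofReal ?_
  have := norm_sub_sq (𝕜 := ℂ) g₀ (g m)
  nlinarith [sq_nonneg ‖g₀ - g m‖]

end WeakConvergence

/-! ### From weak to strong convergence -/

section StrongConvergence

open scoped InnerProductSpace

theorem tendsto_lintegral_compl_closedBall {E : Type*} [NormedAddCommGroup E] [MeasurableSpace E]
    [BorelSpace E] {μ : Measure E} {g : E → ℝ≥0∞} (hg : AEMeasurable g μ)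
    (hfin : ∫⁻ x, g x ∂μ ≠ ⊤) :
    Tendsto (fun R : ℕ => ∫⁻ x in (Metric.closedBall 0 (R : ℝ))ᶜ, g x ∂μ) atTop (𝓝 0) := by
  have hm : ∀ R : ℕ, MeasurableSet (Metric.closedBall (0 : E) (R : ℝ))ᶜ := fun R =>
    Metric.isClosed_closedBall.measurableSet.compl
  simp only [← lintegral_indicator (hm _)]
  rw [show (0 : ℝ≥0∞) = ∫⁻ _, 0 ∂μ by simp]
  refine tendsto_lintegral_of_dominated_convergence' g (fun R => hg.indicator (hm R))
    (fun R => .of_forall fun x => Set.indicator_le_self _ _ _) hfin (.of_forall fun x => ?_)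
  obtain ⟨N, hN⟩ := exists_nat_ge ‖x‖
  refine tendsto_const_nhds.congr' ?_
  filter_upwards [eventually_ge_atTop N] with R hR
  rw [Set.indicator_of_notMem]
  simpa using hN.trans (by exact_mod_cast hR)

/-- The cutoff to `A` is absorbed into the strongly convergent factor, so weak convergence of the
other one suffices. For the current that other factor is a gradient component. -/
theorem tendsto_setIntegral_conj_mul {α : Type*} [MeasurableSpace α] {μ : Measure α}
    {f g : ℕ → Lp ℂ 2 μ} {f₀ g₀ : Lp ℂ 2 μ} {M : ℝ}
    (hf : Tendsto f atTop (𝓝 f₀)) (hM : ∀ m, ‖g m‖ ≤ M)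
    (hg : ∀ u : Lp ℂ 2 μ, Tendsto (fun m => ⟪u, g m⟫_ℂ) atTop (𝓝 ⟪u, g₀⟫_ℂ))
    {A : Set α} (hA : MeasurableSet A) :
    Tendsto (fun m => ∫ x in A, star (f m x) * g m x ∂μ) atTop
      (𝓝 (∫ x in A, star (f₀ x) * g₀ x ∂μ)) := by
  have hmem : ∀ k : Lp ℂ 2 μ, MemLp (A.indicator k) 2 μ := fun k => (Lp.memLp k).indicator hA
  have hind : ∀ k l : Lp ℂ 2 μ,
      ∫ x in A, star (k x) * l x ∂μ = ⟪(hmem k).toLp, l⟫_ℂ := fun k l => by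
    rw [L2.inner_def, ← integral_indicator hA]
    refine integral_congr_ae ((hmem k).coeFn_toLp.mono fun x hx => ?_)
    simp only [hx]
    by_cases hxA : x ∈ A <;> simp [hxA, RCLike.inner_apply, mul_comm]
  simp only [hind]
  refine tendsto_inner_of_tendsto_of_weak ?_ hM hg
  rw [tendsto_iff_edist_tendsto_0] at hf ⊢
  refine tendsto_of_tendsto_of_tendsto_of_le_of_le tendsto_const_nhds hf (fun _ => zero_le)
    fun m => ?_
  rw [Lp.edist_toLp_toLp, Lp.edist_def, ← Set.indicator_sub']
  exact eLpNorm_indicator_le _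

variable {E : Type*} [NormedAddCommGroup E] [MeasureSpace E] [BorelSpace E]
  [NormedSpace ℝ E] [FiniteDimensional ℝ E] [(volume : Measure E).IsAddHaarMeasure]

/-- A bounded tight sequence in `L²`, uniformly continuous under translations, converges strongly
if it converges weakly. -/
theorem tendsto_of_weak_of_tight {f : ℕ → Lp ℂ 2 (volume : Measure E)}
    {f₀ : Lp ℂ 2 (volume : Measure E)} {C : ℝ≥0∞} (hC : C ≠ ⊤) {M : ℝ} (hM : ∀ m, ‖f m‖ ≤ M)
    (htr : ∀ m h, eLpNorm (fun x => f m (x + h) - f m x) 2 volume ≤ ENNReal.ofReal ‖h‖ * C)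
    (htr₀ : ∀ h, eLpNorm (fun x => f₀ (x + h) - f₀ x) 2 volume ≤ ENNReal.ofReal ‖h‖ * C)
    (hweak : ∀ u : Lp ℂ 2 (volume : Measure E),
      Tendsto (fun m => ⟪u, f m⟫_ℂ) atTop (𝓝 ⟪u, f₀⟫_ℂ))
    {τ : ℕ → ℝ≥0∞} (hτ : Tendsto τ atTop (𝓝 0))
    (htight : ∀ m (R : ℕ), ∫⁻ x in (Metric.closedBall 0 (R : ℝ))ᶜ, ‖f m x‖ₑ ^ 2 ≤ τ R) :
    Tendsto f atTop (𝓝 f₀) := by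
  have hsub : ∀ m, ⇑(f m - f₀) =ᵐ[volume] fun x => f m x - f₀ x := fun m => Lp.coeFn_sub _ _
  have hloc := tendsto_eLpNorm_indicator_closedBall (f := fun m => f m - f₀) (C := C + C)
    (by simp [hC]) (M := M + ‖f₀‖)
    (fun m => (norm_sub_le _ _).trans (by gcongr; exact hM m))
    (fun m h => by
      have hmp : MeasurePreserving (fun x : E => x + h) := measurePreserving_add_right volume h
      have ht : ∀ k : Lp ℂ 2 (volume : Measure E),
          AEStronglyMeasurable (fun x => k (x + h) - k x) volume := fun k =>
        (((Lp.memLp k).comp_measurePreserving hmp).sub (Lp.memLp k)).1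
      have e : (fun x => (f m - f₀ : Lp ℂ 2 (volume : Measure E)) (x + h) -
          (f m - f₀ : Lp ℂ 2 (volume : Measure E)) x) =ᵐ[volume]
          (fun x => f m (x + h) - f m x) - fun x => f₀ (x + h) - f₀ x := by
        filter_upwards [hsub m, hmp.quasiMeasurePreserving.ae (hsub m)] with x h1 h2
        rw [h1, h2]
        simp only [Pi.sub_apply]
        ring
      rw [eLpNorm_congr_ae e, mul_add]
      exact (eLpNorm_sub_le (ht _) (ht _) (by norm_num)).trans (add_le_add (htr m h) (htr₀ h)))
    (fun u => by simpa [inner_sub_right] using (hweak u).sub_const ⟪u, f₀⟫_ℂ)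
  have htail₀ := tendsto_lintegral_compl_closedBall (g := fun x => ‖f₀ x‖ₑ ^ 2)
    ((Lp.stronglyMeasurable f₀).enorm.pow_const 2).aemeasurable (by
      rw [← eLpNorm_two_sq_eq_lintegral]
      exact ENNReal.pow_ne_top (Lp.eLpNorm_ne_top f₀))
  rw [tendsto_iff_edist_tendsto_0, ENNReal.tendsto_nhds_zero]
  intro ε hε
  have hε3 : (0 : ℝ≥0∞) < ε / 2 / 2 := by simpa using hε.ne'
  have hsq : (0 : ℝ≥0∞) < (ε / 2 / 2) ^ 2 := by positivity
  -- One radius serves all `m`: the tails of `f m` and of `f₀` outside it cost `ε / 2 / 2` each, the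
  -- ball costs `ε / 2`.
  obtain ⟨R, hR1, hR2⟩ := ((ENNReal.tendsto_nhds_zero.1 hτ _ hsq).and
    (ENNReal.tendsto_nhds_zero.1 htail₀ _ hsq)).exists
  have hε2 : (0 : ℝ≥0∞) < ε / 2 := by simpa using hε.ne'
  filter_upwards [ENNReal.tendsto_nhds_zero.1 (hloc R) _ hε2] with m hm
  set S : Set E := Metric.closedBall 0 (R : ℝ)
  have hS : MeasurableSet S := Metric.isClosed_closedBall.measurableSet
  have htl : ∀ k : Lp ℂ 2 (volume : Measure E), ∫⁻ x in Sᶜ, ‖k x‖ₑ ^ 2 ≤ (ε / 2 / 2) ^ 2 →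
      eLpNorm (Sᶜ.indicator k) 2 volume ≤ ε / 2 / 2 := fun k hk => by
    rw [eLpNorm_indicator_eq_eLpNorm_restrict hS.compl]
    rw [← eLpNorm_two_sq_eq_lintegral] at hk
    exact (ENNReal.pow_le_pow_left_iff two_ne_zero).1 hk
  have e : ⇑(f m - f₀) =ᵐ[volume]
      S.indicator (⇑(f m - f₀)) + (Sᶜ.indicator (f m) - Sᶜ.indicator f₀) := by
    filter_upwards [hsub m] with x hx
    by_cases hxS : x ∈ S
    · simp [hxS]
    · simp only [Pi.add_apply, Pi.sub_apply, Set.indicator_of_notMem hxS,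
        Set.indicator_of_mem (show x ∈ Sᶜ from hxS), hx, zero_add]
  have hms : ∀ (k : Lp ℂ 2 (volume : Measure E)) {T : Set E}, MeasurableSet T →
      AEStronglyMeasurable (T.indicator k) volume := fun k T hT =>
    ((Lp.stronglyMeasurable k).indicator hT).aestronglyMeasurable
  rw [edist_eq_enorm_sub, Lp.enorm_def, eLpNorm_congr_ae e]
  refine (eLpNorm_add_le (hms _ hS) ((hms _ hS.compl).sub (hms _ hS.compl)) (by norm_num)).trans ?_
  refine (add_le_add hm ((eLpNorm_sub_le (hms _ hS.compl) (hms _ hS.compl) (by norm_num)).trans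
    (add_le_add (htl _ ((htight m R).trans hR1)) (htl _ hR2)))).trans ?_
  rw [ENNReal.add_halves, ENNReal.add_halves]

/-- For a fixed test function both sides of the defining identity are inner products with fixed `L²`
functions. -/
theorem HasWeakDeriv.of_weak_limit {f g : ℕ → Lp ℂ 2 (volume : Measure E)}
    {f₀ g₀ : Lp ℂ 2 (volume : Measure E)} {v : E} (h : ∀ m, HasWeakDeriv (f m) v (g m))
    (hf : ∀ u : Lp ℂ 2 (volume : Measure E),
      Tendsto (fun m => ⟪u, f m⟫_ℂ) atTop (𝓝 ⟪u, f₀⟫_ℂ))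
    (hg : ∀ u : Lp ℂ 2 (volume : Measure E),
      Tendsto (fun m => ⟪u, g m⟫_ℂ) atTop (𝓝 ⟪u, g₀⟫_ℂ)) : HasWeakDeriv f₀ v g₀ := by
  refine ⟨(Lp.memLp f₀).locallyIntegrable (by norm_num),
    (Lp.memLp g₀).locallyIntegrable (by norm_num), fun φ hφ hc => ?_⟩
  have key : ∀ χ : E → ℝ, Continuous χ → HasCompactSupport χ →
      ∃ u : Lp ℂ 2 (volume : Measure E), ∀ k : Lp ℂ 2 (volume : Measure E),
        ⟪u, k⟫_ℂ = ∫ x, χ x • k x := fun χ hχ hχc => by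
    have hm : MemLp (fun x => (χ x : ℂ)) 2 volume :=
      (Complex.continuous_ofReal.comp hχ).memLp_of_hasCompactSupport
        (hχc.comp_left (g := ((↑) : ℝ → ℂ)) rfl)
    refine ⟨hm.toLp, fun k => ?_⟩
    rw [L2.inner_def]
    refine integral_congr_ae (hm.coeFn_toLp.mono fun x hx => ?_)
    simp only [hx]
    simp [RCLike.inner_apply, mul_comm]
  obtain ⟨u, hu⟩ := key _ ((hφ.continuous_fderiv (by simp)).clm_apply continuous_const)
    (HasCompactSupport.fderiv_apply_real hc v)
  obtain ⟨w, hw⟩ := key _ hφ.continuous hc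
  rw [← hu, ← hw]
  refine tendsto_nhds_unique (hf u) ?_
  refine (hg w).neg.congr fun m => ?_
  rw [hu, hw, (h m).2.2 φ hφ hc]

end StrongConvergence

/-! ### One-particle marginals -/

section Marginals

variable {n : ℕ} {G : Type*} [NormedAddCommGroup G]

theorem piFinSuccAbove_zero_symm_apply (p : R3 × Config n) :
    (MeasurableEquiv.piFinSuccAbove (fun _ : Fin (n + 1) => R3) 0).symm p =
      Fin.cons p.1 p.2 :=
  Fin.insertNth_zero' p.1 p.2

theorem integrable_marginal {F : Config (n + 1) → G} (hF : Integrable F) :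
    Integrable (fun p : R3 × Config n => F (Fin.cons p.1 p.2)) := by
  have hmp := (volume_preserving_piFinSuccAbove (fun _ : Fin (n + 1) => R3) 0).symm
  refine (hmp.integrable_comp_of_integrable hF).congr (.of_forall fun p => ?_)
  rw [Function.comp_apply, piFinSuccAbove_zero_symm_apply]

theorem setIntegral_marginal [NormedSpace ℝ G] {F : Config (n + 1) → G} (hF : Integrable F)
    (A : Set R3) :
    ∫ x in {x : Config (n + 1) | x 0 ∈ A}, F x = ∫ a in A, ∫ y : Config n, F (Fin.cons a y) := by
  have hmp := (volume_preserving_piFinSuccAbove (fun _ : Fin (n + 1) => R3) 0).symm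
  rw [← hmp.setIntegral_preimage_emb (MeasurableEquiv.measurableEmbedding _)]
  have hpre : (MeasurableEquiv.piFinSuccAbove (fun _ : Fin (n + 1) => R3) 0).symm ⁻¹'
      {x : Config (n + 1) | x 0 ∈ A} = A ×ˢ Set.univ := by
    ext p
    simp
  rw [hpre]
  simp only [piFinSuccAbove_zero_symm_apply]
  have h2 := setIntegral_prod (fun p : R3 × Config n => F (Fin.cons p.1 p.2)) (s := A)
    (t := Set.univ) (μ := volume) (ν := volume) (integrable_marginal hF).integrableOn
  rw [Measure.restrict_univ] at h2
  exact h2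

/-- If the marginals of a sequence coincide and its integrals over all cylinders converge, the
marginal of the limit is the same. -/
theorem marginal_ae_eq_of_tendsto {F : ℕ → Config (n + 1) → ℂ} {F₀ : Config (n + 1) → ℂ}
    (hF : ∀ m, Integrable (F m)) (hF₀ : Integrable F₀)
    (hlim : ∀ A : Set R3, MeasurableSet A → Tendsto
      (fun m => ∫ x in {x : Config (n + 1) | x 0 ∈ A}, F m x) atTop
      (𝓝 (∫ x in {x : Config (n + 1) | x 0 ∈ A}, F₀ x)))
    (L : ℂ →L[ℝ] ℝ) (c : ℝ) {g : R3 → ℝ}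
    (hg : ∀ m, ∀ᵐ a, c * L (∫ y : Config n, F m (Fin.cons a y)) = g a) :
    ∀ᵐ a, c * L (∫ y : Config n, F₀ (Fin.cons a y)) = g a := by
  have hI : ∀ {K : Config (n + 1) → ℂ}, Integrable K →
      Integrable fun a => c * L (∫ y : Config n, K (Fin.cons a y)) := fun hK =>
    (L.integrable_comp (integrable_marginal hK).integral_prod_left).const_mul c
  have hset : ∀ {K : Config (n + 1) → ℂ}, Integrable K → ∀ A : Set R3,
      ∫ a in A, c * L (∫ y : Config n, K (Fin.cons a y)) =
        c * L (∫ x in {x : Config (n + 1) | x 0 ∈ A}, K x) := fun {K} hK A => by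
    rw [setIntegral_marginal hK A, integral_const_mul,
      L.integral_comp_comm (integrable_marginal hK).integral_prod_left.integrableOn]
  -- Integrability of `g` comes from any single member of the sequence, whose marginal it is.
  have hgI : Integrable g := (hI (hF 0)).congr (hg 0)
  refine Integrable.ae_eq_of_forall_setIntegral_eq _ _ (hI hF₀) hgI fun A hA _ => ?_
  rw [hset hF₀ A]
  have h1 := ((L.continuous.tendsto _).comp (hlim A hA)).const_mul c
  refine tendsto_nhds_unique h1 (tendsto_const_nhds.congr fun m => ?_)
  rw [Function.comp_apply, ← hset (hF m) A]
  exact integral_congr_ae (ae_restrict_of_ae ((hg m).mono fun a ha => ha.symm))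

end Marginals

/-! ### Antisymmetry, gradients and Coulomb energy on configuration space -/

section Configurations

variable {N : ℕ}

theorem measurePreserving_permute (σ : Equiv.Perm (Fin N)) :
    MeasurePreserving (fun (x : Config N) (k : Fin N) => x (σ k)) := by
  have h := volume_measurePreserving_piCongrLeft (fun _ : Fin N => R3) σ.symm
  convert! h using 1
  funext x k
  obtain ⟨i, rfl⟩ := σ.symm.surjective k
  simp [MeasurableEquiv.piCongrLeft]

theorem Antisymmetric.of_tendsto {f : ℕ → Config N → ℂ} {f₀ : Config N → ℂ}
    (h : ∀ m, Antisymmetric (f m))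
    (hlim : ∀ᵐ x, Tendsto (fun m => f m x) atTop (𝓝 (f₀ x))) : Antisymmetric f₀ := by
  intro σ
  filter_upwards [ae_all_iff.2 fun m => h m σ, hlim,
    (measurePreserving_permute σ).quasiMeasurePreserving.ae hlim] with x h1 h2 h3
  simp only [h1] at h3
  exact tendsto_nhds_unique h3 (h2.const_mul _)

/-- Swapping particles `0` and `k` preserves the measure and changes `f` only by a sign. -/
theorem Antisymmetric.lintegral_coord_eq {f : Config (N + 1) → ℂ} (h : Antisymmetric f)
    (A : Set R3) (k : Fin (N + 1)) :
    ∫⁻ x in {x : Config (N + 1) | x k ∈ A}, ‖f x‖ₑ ^ 2 =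
      ∫⁻ x in {x : Config (N + 1) | x 0 ∈ A}, ‖f x‖ₑ ^ 2 := by
  set σ : Equiv.Perm (Fin (N + 1)) := Equiv.swap 0 k
  set e := MeasurableEquiv.piCongrLeft (fun _ : Fin (N + 1) => R3) σ.symm
  have hmp : MeasurePreserving e := volume_measurePreserving_piCongrLeft _ _
  have he : ∀ x : Config (N + 1), e x = fun i => x (σ i) := fun x => by
    funext i
    obtain ⟨i, rfl⟩ := σ.symm.surjective i
    simp [e, MeasurableEquiv.piCongrLeft]
  rw [← hmp.setLIntegral_comp_preimage_emb e.measurableEmbedding (fun x => ‖f x‖ₑ ^ 2)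
    {x | x 0 ∈ A}]
  have hpre : e ⁻¹' {x | x 0 ∈ A} = {x : Config (N + 1) | x k ∈ A} := by
    ext x
    simp [he, σ]
  rw [hpre]
  refine lintegral_congr_ae (ae_restrict_of_ae ((h σ).mono fun x hx => ?_))
  have h1 : ‖(((Equiv.Perm.sign σ : ℤˣ) : ℤ) : ℂ)‖ₑ = 1 := by
    rcases Int.units_eq_one_or (Equiv.Perm.sign σ) with h | h <;> simp [h]
  simp only [he, hx, enorm_mul, h1, one_mul]

theorem Config.eq_sum_dir (v : Config N) : v = ∑ p : Fin N × Fin 3, v p.1 p.2 • dir p.1 p.2 := by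
  funext k
  ext i
  simp only [Finset.sum_apply, WithLp.ofLp_sum, Pi.smul_apply, WithLp.ofLp_smul, smul_eq_mul, dir]
  rw [Finset.sum_eq_single (k, i)]
  · simp
  · rintro ⟨k', i'⟩ - hne
    by_cases hk : k = k'
    · subst hk
      have : i ≠ i' := fun h => hne (by rw [h])
      simp [this]
    · simp [hk]
  · simp

/-- The gradient in coordinates determines the weak derivative in every direction. -/
theorem HasWeakDeriv.of_dir {f : Config N → ℂ} {g : Fin N × Fin 3 → Config N → ℂ}
    (hf : LocallyIntegrable f volume) (h : ∀ p, HasWeakDeriv f (dir p.1 p.2) (g p))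
    (v : Config N) : HasWeakDeriv f v (fun x => ∑ p, v p.1 p.2 • g p x) := by
  have := HasWeakDeriv.sum_dir hf Finset.univ fun p _ => (h p).smul_dir (v p.1 p.2)
  rwa [← Config.eq_sum_dir] at this

theorem memH1_of_dir {f : Config N → ℂ} {g : Fin N × Fin 3 → Config N → ℂ}
    (hf : MemLp f 2 volume) (h : ∀ p, HasWeakDeriv f (dir p.1 p.2) (g p))
    (hg : ∀ p, MemLp (g p) 2 volume) : MemH1 f :=
  ⟨hf, fun v => ⟨_, HasWeakDeriv.of_dir (hf.locallyIntegrable (by norm_num)) h v,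
    memLp_finsetSum _ fun p _ => (hg p).const_smul (v p.1 p.2)⟩⟩

theorem eLpNorm_translate_sub_le_of_dir {f : Config N → ℂ} {g : Fin N × Fin 3 → Config N → ℂ}
    (hf : MemLp f 2 volume) (h : ∀ p, HasWeakDeriv f (dir p.1 p.2) (g p))
    (hg : ∀ p, MemLp (g p) 2 volume) (v : Config N) :
    eLpNorm (fun x => f (x + v) - f x) 2 volume ≤
      ENNReal.ofReal ‖v‖ * ∑ p, eLpNorm (g p) 2 volume := by
  have hm : ∀ p ∈ (Finset.univ : Finset (Fin N × Fin 3)),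
      MemLp (fun x => v p.1 p.2 • g p x) 2 volume := fun p _ => (hg p).const_smul (v p.1 p.2)
  refine ((HasWeakDeriv.of_dir (hf.locallyIntegrable (by norm_num)) h v).eLpNorm_translate_sub_le
    hf (memLp_finsetSum _ hm)).trans ?_
  have e : (fun x => ∑ p, v p.1 p.2 • g p x) = ∑ p, fun x => v p.1 p.2 • g p x := by
    funext x
    simp
  rw [e, Finset.mul_sum]
  refine (eLpNorm_sum_le (fun p hp => (hm p hp).1) (by norm_num)).trans
    (Finset.sum_le_sum fun p _ => ?_)
  change eLpNorm (v p.1 p.2 • g p) 2 volume ≤ _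
  rw [eLpNorm_const_smul, ← ofReal_norm]
  gcongr
  exact (PiLp.norm_apply_le (v p.1) p.2).trans (norm_le_pi_norm v p.1)

theorem MemH1.hasWeakDeriv_partialD {f : Config N → ℂ} (h : MemH1 f) (k : Fin N) (i : Fin 3) :
    HasWeakDeriv f (dir k i) (partialD f k i) :=
  hasWeakDeriv_weakDeriv (h.2 (dir k i)).choose_spec.1

theorem MemH1.memLp_partialD {f : Config N → ℂ} (h : MemH1 f) (k : Fin N) (i : Fin 3) :
    MemLp (partialD f k i) 2 volume :=
  (h.2 (dir k i)).choose_spec.2.ae_eq (weakDeriv_ae_eq (h.2 (dir k i)).choose_spec.1).symm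

theorem kinetic_eq_sum_eLpNorm (f : Config N → ℂ) :
    kinetic f = ∑ p : Fin N × Fin 3, eLpNorm (partialD f p.1 p.2) 2 volume ^ 2 := by
  simp only [kinetic, eLpNorm_two_sq_eq_lintegral, Fintype.sum_prod_type]

theorem density_eq_re {n : ℕ} (f : Config (n + 1) → ℂ) (x : R3) :
    density f x = ((n + 1 : ℕ) : ℝ) *
      Complex.reCLM (∫ y : Config n, star (f (Fin.cons x y)) * f (Fin.cons x y)) := by
  have e : ∀ y : Config n, star (f (Fin.cons x y)) * f (Fin.cons x y) =
      ((‖f (Fin.cons x y)‖ ^ 2 : ℝ) : ℂ) := fun y => by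
    simp [Complex.conj_mul']
  simp only [e, density]
  rw [integral_complex_ofReal]
  simp

/-- The mass of an antisymmetric function outside a large ball is controlled by its density. -/
theorem lintegral_compl_closedBall_le_density {n : ℕ} {f : Config (n + 1) → ℂ}
    (hf : MemLp f 2 volume) (ha : Antisymmetric f) {R : ℝ} (hR : 0 ≤ R) :
    ∫⁻ x in (Metric.closedBall 0 R)ᶜ, ‖f x‖ₑ ^ 2 ≤
      ∫⁻ a in (Metric.closedBall 0 R)ᶜ, ‖density f a‖ₑ := by
  set A : Set R3 := (Metric.closedBall 0 R)ᶜ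
  -- The norm of `Config` is the maximum over the particles, so outside the ball some particle is
  -- farther than `R`. The resulting `n + 1` equal cylinder integrals account for the factor `n + 1`
  -- in `density`.
  have hcover : (Metric.closedBall (0 : Config (n + 1)) R)ᶜ ⊆
      ⋃ k : Fin (n + 1), {x : Config (n + 1) | x k ∈ A} := fun x hx => by
    simp only [Set.mem_iUnion, Set.mem_ofPred_eq, A, Set.mem_compl_iff, mem_closedBall_zero_iff,
      not_le] at hx ⊢
    by_contra! hcon
    exact hx.not_ge ((pi_norm_le_iff_of_nonneg hR).2 hcon)
  have hint : Integrable (fun x => ‖f x‖ ^ 2) := hf.integrable_norm_pow (by norm_num)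
  have hreal : ∫ x in {x : Config (n + 1) | x 0 ∈ A}, ‖f x‖ ^ 2 =
      ∫ a in A, ∫ y : Config n, ‖f (Fin.cons a y)‖ ^ 2 := setIntegral_marginal hint A
  have hint' := (integrable_marginal hint).integral_prod_left
  have h1 : ∫⁻ x in {x : Config (n + 1) | x 0 ∈ A}, ‖f x‖ₑ ^ 2 =
      ∫⁻ a in A, ‖∫ y : Config n, ‖f (Fin.cons a y)‖ ^ 2‖ₑ := by
    have e1 := ofReal_integral_norm_eq_lintegral_enorm
      (hint.integrableOn (s := {x : Config (n + 1) | x 0 ∈ A}))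
    have e2 := ofReal_integral_norm_eq_lintegral_enorm (hint'.integrableOn (s := A))
    have n1 : ∀ x, ‖‖f x‖ ^ 2‖ = ‖f x‖ ^ 2 := fun x => by simp
    have n2 : ∀ a : R3, ‖∫ y : Config n, ‖f (Fin.cons a y)‖ ^ 2‖ =
        ∫ y : Config n, ‖f (Fin.cons a y)‖ ^ 2 := fun a =>
      Real.norm_of_nonneg (integral_nonneg fun _ => by positivity)
    simp only [n1] at e1
    simp only [n2] at e2
    rw [← e2, ← hreal, e1]
    simp
  calc ∫⁻ x in (Metric.closedBall 0 R)ᶜ, ‖f x‖ₑ ^ 2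
      ≤ ∫⁻ x in ⋃ k : Fin (n + 1), {x : Config (n + 1) | x k ∈ A}, ‖f x‖ₑ ^ 2 :=
        lintegral_mono_set hcover
    _ ≤ ∑' k : Fin (n + 1), ∫⁻ x in {x : Config (n + 1) | x k ∈ A}, ‖f x‖ₑ ^ 2 :=
        lintegral_iUnion_le _ _
    _ = ((n + 1 : ℕ) : ℝ≥0∞) * ∫⁻ a in A, ‖∫ y : Config n, ‖f (Fin.cons a y)‖ ^ 2‖ₑ := by
        simp only [ha.lintegral_coord_eq A, h1, tsum_fintype]
        simp
    _ = ∫⁻ a in A, ‖density f a‖ₑ := by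
        rw [← lintegral_const_mul' _ _ (ENNReal.natCast_ne_top _)]
        refine lintegral_congr fun a => ?_
        rw [density, enorm_mul]
        congr 1
        rw [← ofReal_norm, Real.norm_natCast, ENNReal.ofReal_natCast]

theorem coulomb_eq_lintegral {f : Config N → ℂ} (hf : AEStronglyMeasurable f volume) :
    coulomb f = ∫⁻ x, ‖f x‖ₑ ^ 2 * ∑ k : Fin N, ∑ l ∈ Finset.Ioi k, ‖x k - x l‖ₑ⁻¹ := by
  have hm : ∀ k l : Fin N, AEMeasurable
      (fun x : Config N => ‖f x‖ₑ ^ 2 * ‖x k - x l‖ₑ⁻¹) volume := fun k l =>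
    (hf.enorm.pow_const 2).mul (by fun_prop)
  simp only [Finset.mul_sum, coulomb, div_eq_mul_inv]
  rw [lintegral_finsetSum' _ fun k _ => Finset.aemeasurable_fun_sum _ fun l _ => hm k l]
  refine Finset.sum_congr rfl fun k _ => ?_
  rw [lintegral_finsetSum' _ fun l _ => hm k l]

theorem coulomb_le_liminf {f : ℕ → Config N → ℂ} {f₀ : Config N → ℂ}
    (hf : ∀ m, AEStronglyMeasurable (f m) volume) (hf₀ : AEStronglyMeasurable f₀ volume)
    (hlim : ∀ᵐ x, Tendsto (fun m => f m x) atTop (𝓝 (f₀ x))) :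
    coulomb f₀ ≤ liminf (fun m => coulomb (f m)) atTop := by
  simp only [coulomb_eq_lintegral (hf _), coulomb_eq_lintegral hf₀]
  refine le_trans (lintegral_mono_ae (hlim.mono fun x hx => ?_))
    (lintegral_liminf_le' fun m => ((hf m).enorm.pow_const 2).mul
      (Measurable.aemeasurable (by fun_prop)))
  set c := ∑ k : Fin N, ∑ l ∈ Finset.Ioi k, ‖x k - x l‖ₑ⁻¹
  -- The weight `c` is infinite where particles coincide, and multiplication by `∞` is discontinuous
  -- at `0`. Where `f₀` vanishes the left side is `0 * c = 0` anyway.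
  rcases eq_or_ne (‖f₀ x‖ₑ ^ 2) 0 with h0 | h0
  · rw [h0, zero_mul]
    exact zero_le
  · have h1 : Tendsto (fun m => ‖f m x‖ₑ ^ 2) atTop (𝓝 (‖f₀ x‖ₑ ^ 2)) :=
      ((ENNReal.continuous_pow 2).tendsto _).comp hx.enorm
    exact (ENNReal.Tendsto.mul_const h1 (.inl h0)).liminf_eq.ge

end Configurations

/-! ### Compactness of the constraint set and existence of minimizers -/

section Minimizers

open scoped InnerProductSpace

theorem tendsto_inner_apply_of_weak {ι α : Type*} [Fintype ι] [MeasurableSpace α] {μ : Measure α}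
    {g : ℕ → PiLp 2 fun _ : ι => Lp ℂ 2 μ} {g₀ : PiLp 2 fun _ : ι => Lp ℂ 2 μ}
    (h : ∀ u : PiLp 2 fun _ : ι => Lp ℂ 2 μ,
      Tendsto (fun m => ⟪u, g m⟫_ℂ) atTop (𝓝 ⟪u, g₀⟫_ℂ)) (p : ι) (u : Lp ℂ 2 μ) :
    Tendsto (fun m => ⟪u, g m p⟫_ℂ) atTop (𝓝 ⟪u, g₀ p⟫_ℂ) := by
  classical
  have e : ∀ k : PiLp 2 fun _ : ι => Lp ℂ 2 μ,
      ⟪(WithLp.toLp 2 (Pi.single p u) : PiLp 2 fun _ : ι => Lp ℂ 2 μ), k⟫_ℂ = ⟪u, k p⟫_ℂ :=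
    fun k => by
      rw [PiLp.inner_apply, Finset.sum_eq_single p]
      · simp
      · intro b _ hb
        simp [Pi.single_eq_of_ne hb]
      · simp
  simpa only [e] using h (WithLp.toLp 2 (Pi.single p u))

theorem enorm_sq_eq_sum {ι α : Type*} [Fintype ι] [MeasurableSpace α] {μ : Measure α}
    (g : PiLp 2 fun _ : ι => Lp ℂ 2 μ) : ‖g‖ₑ ^ 2 = ∑ p, eLpNorm (g p) 2 μ ^ 2 := by
  have h1 : ∀ p, eLpNorm (g p) 2 μ ^ 2 = ENNReal.ofReal (‖g p‖ ^ 2) := fun p => by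
    rw [← Lp.enorm_def, ← ofReal_norm, ENNReal.ofReal_pow (norm_nonneg _)]
  rw [← ofReal_norm, ← ENNReal.ofReal_pow (norm_nonneg _), PiLp.norm_sq_eq_of_L2,
    ENNReal.ofReal_sum_of_nonneg fun p _ => by positivity]
  exact Finset.sum_congr rfl fun p _ => (h1 p).symm

/-- Wave functions with given density and current and bounded kinetic energy form a compact set. -/
theorem exists_subseq_tendsto_of_yields {n : ℕ} {ρ : R3 → ℝ} {j : R3 → R3}
    {ψ : ℕ → Config (n + 1) → ℂ} (hW : ∀ m, ψ m ∈ W (n + 1)) (hY : ∀ m, Yields (ψ m) ρ j)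
    {K : ℝ≥0∞} (hK : K ≠ ⊤) (hkin : ∀ m, kinetic (ψ m) ≤ K) :
    ∃ φ ∈ W (n + 1), Yields φ ρ j ∧ ∃ s : ℕ → ℕ, StrictMono s ∧
      (∀ᵐ x, Tendsto (fun m => ψ (s m) x) atTop (𝓝 (φ x))) ∧
      kinetic φ ≤ liminf (fun m => kinetic (ψ (s m))) atTop := by
  have hmem : ∀ m, MemLp (ψ m) 2 volume := fun m => (hW m).1.1
  have hgmem : ∀ m (p : Fin (n + 1) × Fin 3), MemLp (partialD (ψ m) p.1 p.2) 2 volume :=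
    fun m p => (hW m).1.memLp_partialD p.1 p.2
  set f : ℕ → Lp ℂ 2 (volume : Measure (Config (n + 1))) := fun m => (hmem m).toLp
  -- Collecting all gradient components in one Hilbert space makes the kinetic energy a squared
  -- norm: one extraction and one semicontinuity inequality handle every component.
  set g : ℕ → PiLp 2 fun _ : Fin (n + 1) × Fin 3 => Lp ℂ 2 (volume : Measure (Config (n + 1))) :=
    fun m => WithLp.toLp 2 fun p => (hgmem m p).toLp
  have hfae : ∀ m, f m =ᵐ[volume] ψ m := fun m => (hmem m).coeFn_toLp
  have hgae : ∀ m p, g m p =ᵐ[volume] partialD (ψ m) p.1 p.2 := fun m p => (hgmem m p).coeFn_toLp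
  have hgkin : ∀ m, ‖g m‖ₑ ^ 2 = kinetic (ψ m) := fun m => by
    rw [enorm_sq_eq_sum, kinetic_eq_sum_eLpNorm]
    exact Finset.sum_congr rfl fun p _ => by rw [eLpNorm_congr_ae (hgae m p)]
  -- uniform bounds
  have hfnorm : ∀ m, ‖f m‖ = 1 := fun m => by
    rw [Lp.norm_def, eLpNorm_congr_ae (hfae m), (hW m).2.2, ENNReal.toReal_one]
  -- Adding `1` gives `K ≤ C ≤ C ^ 2`, which bounds `‖g m‖ₑ` without a square root.
  set C : ℝ≥0∞ := K + 1 with hCdef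
  have hC : C ≠ ⊤ := by simp [hCdef, hK]
  have hC1 : 1 ≤ C := le_add_self
  have hgC : ∀ m, ‖g m‖ₑ ≤ C := fun m => by
    rw [← ENNReal.pow_le_pow_left_iff two_ne_zero, hgkin]
    calc kinetic (ψ m) ≤ K := hkin m
      _ ≤ C := le_self_add
      _ = C ^ 1 := (pow_one C).symm
      _ ≤ C ^ 2 := pow_le_pow_right₀ hC1 (by norm_num)
  have hgpC : ∀ m p, ‖g m p‖ₑ ≤ C := fun m p => by
    refine le_trans ?_ (hgC m)
    rw [← ofReal_norm, ← ofReal_norm]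
    exact ENNReal.ofReal_le_ofReal (PiLp.norm_apply_le (g m) p)
  have htoReal : ∀ {H : Type} [NormedAddCommGroup H] (x : H), ‖x‖ₑ ≤ C → ‖x‖ ≤ C.toReal :=
    fun x hx => by
      rw [← toReal_enorm]
      exact ENNReal.toReal_mono hC hx
  -- weak limits
  have : Fact ((2 : ℝ≥0∞) ≠ ⊤) := ⟨by norm_num⟩
  have : TopologicalSpace.SeparableSpace
      (PiLp 2 fun _ : Fin (n + 1) × Fin 3 => Lp ℂ 2 (volume : Measure (Config (n + 1)))) :=
    (WithLp.toLp_surjective 2).denseRange.separableSpace (PiLp.continuous_toLp 2 _)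
  obtain ⟨g₀, s₁, hs₁, hg₁⟩ := exists_subseq_tendsto_inner (f := g) fun m => htoReal _ (hgC m)
  obtain ⟨f₀, s₂, hs₂, hf₂⟩ := exists_subseq_tendsto_inner (f := fun m => f (s₁ m)) (M := 1)
    fun m => (hfnorm _).le
  have hg₂ : ∀ u, Tendsto (fun m => ⟪u, g (s₁ (s₂ m))⟫_ℂ) atTop (𝓝 ⟪u, g₀⟫_ℂ) := fun u =>
    (hg₁ u).comp hs₂.tendsto_atTop
  have hweak : ∀ m (p : Fin (n + 1) × Fin 3), HasWeakDeriv (f m) (dir p.1 p.2) (g m p) :=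
    fun m p => ((hW m).1.hasWeakDeriv_partialD p.1 p.2).congr (hfae m).symm (hgae m p).symm
  have hweak₀ : ∀ p : Fin (n + 1) × Fin 3, HasWeakDeriv f₀ (dir p.1 p.2) (g₀ p) := fun p =>
    HasWeakDeriv.of_weak_limit (f := fun m => f (s₁ (s₂ m))) (g := fun m => g (s₁ (s₂ m)) p)
      (fun m => hweak _ p) hf₂ (tendsto_inner_apply_of_weak hg₂ p)
  have hH1 : MemH1 f₀ := memH1_of_dir (Lp.memLp f₀) hweak₀ fun p => Lp.memLp (g₀ p)
  -- strong convergence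
  set D : ℝ≥0∞ := ∑ _p : Fin (n + 1) × Fin 3, C + ∑ p, eLpNorm (g₀ p) 2 volume with hD
  have hDtop : D ≠ ⊤ := ENNReal.add_ne_top.2
    ⟨ENNReal.sum_ne_top.2 fun _ _ => hC, ENNReal.sum_ne_top.2 fun p _ => Lp.eLpNorm_ne_top _⟩
  have hρ : Integrable ρ := by
    have hI := (hmem 0).star.integrable_mul (hmem 0)
    refine ((Complex.reCLM.integrable_comp (integrable_marginal hI).integral_prod_left).const_mul
      ((n + 1 : ℕ) : ℝ)).congr ((hY 0).1.mono fun x hx => ?_)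
    rw [← hx, density_eq_re]
    rfl
  have hstrong : Tendsto (fun m => f (s₁ (s₂ m))) atTop (𝓝 f₀) := by
    refine tendsto_of_weak_of_tight hDtop (fun m => (hfnorm _).le) (fun m h => ?_) (fun h => ?_)
      hf₂ (tendsto_lintegral_compl_closedBall (g := fun a => ‖ρ a‖ₑ) hρ.1.enorm hρ.2.ne)
      fun m R => ?_
    · refine (eLpNorm_translate_sub_le_of_dir (Lp.memLp _) (hweak _)
        (fun p => Lp.memLp _) h).trans ?_
      gcongr
      refine le_trans (Finset.sum_le_sum fun p _ => ?_) le_self_add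
      rw [← Lp.enorm_def]
      exact hgpC _ p
    · refine (eLpNorm_translate_sub_le_of_dir (Lp.memLp _) hweak₀ (fun p => Lp.memLp _) h).trans ?_
      gcongr
      exact le_add_self
    · have h1 := lintegral_compl_closedBall_le_density (hmem (s₁ (s₂ m))) (hW _).2.1
        (Nat.cast_nonneg R)
      calc _ = ∫⁻ x in (Metric.closedBall 0 (R : ℝ))ᶜ, ‖ψ (s₁ (s₂ m)) x‖ₑ ^ 2 :=
            lintegral_congr_ae (ae_restrict_of_ae ((hfae (s₁ (s₂ m))).mono fun x hx => by simp only [hx]))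
        _ ≤ _ := h1
        _ = _ := lintegral_congr_ae (ae_restrict_of_ae ((hY (s₁ (s₂ m))).1.mono fun x hx => by
            simp only [hx]))
  -- pointwise convergence along a further subsequence
  obtain ⟨s₃, hs₃, hae⟩ := (tendstoInMeasure_of_tendsto_Lp hstrong).exists_seq_tendsto_ae
  have haeψ : ∀ᵐ x, Tendsto (fun m => ψ (s₁ (s₂ (s₃ m))) x) atTop (𝓝 (f₀ x)) := by
    filter_upwards [hae, ae_all_iff.2 fun m => hfae m] with x h1 h2
    simpa only [h2] using h1
  have hnorm₀ : eLpNorm f₀ 2 volume = 1 := by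
    have h1 : ‖f₀‖ = 1 := tendsto_nhds_unique hstrong.norm (by simp [hfnorm])
    rw [← Lp.enorm_def, ← ofReal_norm, h1, ENNReal.ofReal_one]
  have hpartial : ∀ p : Fin (n + 1) × Fin 3, partialD f₀ p.1 p.2 =ᵐ[volume] g₀ p := fun p =>
    weakDeriv_ae_eq (hweak₀ p)
  refine ⟨f₀, ⟨hH1, Antisymmetric.of_tendsto (fun m => (hW _).2.1) haeψ, hnorm₀⟩, ?_,
    fun m => s₁ (s₂ (s₃ m)), hs₁.comp (hs₂.comp hs₃), haeψ, ?_⟩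
  · constructor
    · have h1 := marginal_ae_eq_of_tendsto (F := fun m x => star (ψ (s₁ (s₂ m)) x) *
        ψ (s₁ (s₂ m)) x) (F₀ := fun x => star (f₀ x) * f₀ x)
        (fun m => (hmem _).star.integrable_mul (hmem _))
        ((Lp.memLp f₀).star.integrable_mul (Lp.memLp f₀))
        (fun A hA => by
          refine (tendsto_setIntegral_conj_mul hstrong (fun m => (hfnorm _).le) hf₂
            (A := {x : Config (n + 1) | x 0 ∈ A}) (measurable_pi_apply 0 hA)).congr fun m => ?_
          exact integral_congr_ae (ae_restrict_of_ae ((hfae (s₁ (s₂ m))).mono fun x hx => by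
            simp only [hx])))
        Complex.reCLM ((n + 1 : ℕ) : ℝ) (g := ρ)
        (fun m => (hY (s₁ (s₂ m))).1.mono fun x hx => by rw [← hx, density_eq_re])
      exact h1.mono fun x hx => by rw [density_eq_re, hx]
    · have h1 : ∀ i : Fin 3, ∀ᵐ x, current f₀ x i = j x i := fun i => by
        exact marginal_ae_eq_of_tendsto (F := fun m x => star (ψ (s₁ (s₂ m)) x) *
          partialD (ψ (s₁ (s₂ m))) 0 i x) (F₀ := fun x => star (f₀ x) * partialD f₀ 0 i x)
          (fun m => (hmem _).star.integrable_mul (hgmem _ (0, i)))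
          ((Lp.memLp f₀).star.integrable_mul (hH1.memLp_partialD 0 i))
          (fun A hA => by
            have h2 := tendsto_setIntegral_conj_mul hstrong
              (g := fun m => g (s₁ (s₂ m)) (0, i)) (g₀ := g₀ (0, i))
              (fun m => htoReal _ (hgpC _ _))
              (tendsto_inner_apply_of_weak hg₂ (0, i))
              (A := {x : Config (n + 1) | x 0 ∈ A}) (measurable_pi_apply 0 hA)
            have h3 : ∫ x in {x : Config (n + 1) | x 0 ∈ A}, star (f₀ x) * partialD f₀ 0 i x =
                ∫ x in {x : Config (n + 1) | x 0 ∈ A}, star (f₀ x) * g₀ (0, i) x :=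
              integral_congr_ae (ae_restrict_of_ae ((hpartial (0, i)).mono fun x hx => by
                simp only [hx]))
            rw [h3]
            refine h2.congr fun m => integral_congr_ae (ae_restrict_of_ae ?_)
            filter_upwards [hfae (s₁ (s₂ m)), hgae (s₁ (s₂ m)) (0, i)] with x h4 h5
            rw [h4, h5])
          Complex.imCLM ((n + 1 : ℕ) : ℝ) (g := fun x => j x i)
          (fun m => (hY (s₁ (s₂ m))).2.mono fun x hx => by rw [← hx]; rfl)
      filter_upwards [ae_all_iff.2 h1] with x hx
      ext i
      exact hx i
  · have h1 : kinetic f₀ = ‖g₀‖ₑ ^ 2 := by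
      rw [enorm_sq_eq_sum, kinetic_eq_sum_eLpNorm]
      exact Finset.sum_congr rfl fun p _ => by rw [eLpNorm_congr_ae (hpartial p)]
    rw [h1]
    refine (enorm_le_liminf_of_weak fun u => (hg₂ u).comp hs₃.tendsto_atTop).trans_eq ?_
    simp only [hgkin]

/-- The kinetic energy plus any potential energy that is lower semicontinuous under pointwise
convergence attains its infimum over the wave functions with given density and current. -/
theorem exists_minimizer {n : ℕ} {ρ : R3 → ℝ} {j : R3 → R3} (hrep : IsNRepresentable n ρ j)
    (V : (Config (n + 1) → ℂ) → ℝ≥0∞)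
    (hV : ∀ (f : ℕ → Config (n + 1) → ℂ) (f₀ : Config (n + 1) → ℂ),
      (∀ m, AEStronglyMeasurable (f m) volume) → AEStronglyMeasurable f₀ volume →
      (∀ᵐ x, Tendsto (fun m => f m x) atTop (𝓝 (f₀ x))) →
      V f₀ ≤ liminf (fun m => V (f m)) atTop) :
    ∃ ψ ∈ W (n + 1), Yields ψ ρ j ∧
      sInf {e | ∃ φ ∈ W (n + 1), Yields φ ρ j ∧ e = kinetic φ + V φ} = kinetic ψ + V ψ := by
  set S : Set ℝ≥0∞ := {e | ∃ φ ∈ W (n + 1), Yields φ ρ j ∧ e = kinetic φ + V φ} with hS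
  obtain ⟨ψ₀, hψ₀, hY₀⟩ := hrep
  have hmem : ∀ φ ∈ W (n + 1), Yields φ ρ j → sInf S ≤ kinetic φ + V φ := fun φ h1 h2 =>
    sInf_le ⟨φ, h1, h2, rfl⟩
  rcases eq_or_ne (sInf S) ⊤ with htop | htop
  -- If the infimum is infinite, every admissible wave function attains it.
  · exact ⟨ψ₀, hψ₀, hY₀, le_antisymm (hmem _ hψ₀ hY₀) (by rw [htop]; exact le_top)⟩
  obtain ⟨e, -, hlim, he⟩ := exists_seq_tendsto_sInf (S := S) ⟨_, ψ₀, hψ₀, hY₀, rfl⟩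
    (OrderBot.bddBelow _)
  -- Dropping the first `m₀` terms bounds every remaining energy, hence every kinetic energy, by
  -- `sInf S + 1`.
  obtain ⟨m₀, hm₀⟩ := eventually_atTop.1 (hlim.eventually (eventually_le_nhds
    (ENNReal.lt_add_right htop one_ne_zero)))
  choose ψ hψW hψY hψe using fun m => he (m + m₀)
  have hlim' : Tendsto (fun m => kinetic (ψ m) + V (ψ m)) atTop (𝓝 (sInf S)) :=
    (hlim.comp (tendsto_add_atTop_nat m₀)).congr hψe
  obtain ⟨φ, hφW, hφY, s, hs, hae, hkin⟩ := exists_subseq_tendsto_of_yields hψW hψY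
    (K := sInf S + 1) (by simp [htop])
    (fun m => le_self_add.trans ((hψe m).symm.trans_le (hm₀ _ (Nat.le_add_left _ _))))
  refine ⟨φ, hφW, hφY, le_antisymm (hmem φ hφW hφY) ?_⟩
  calc kinetic φ + V φ
      ≤ liminf (fun m => kinetic (ψ (s m))) atTop + liminf (fun m => V (ψ (s m))) atTop :=
        add_le_add hkin (hV _ _ (fun m => (hψW _).1.1.1) hφW.1.1.1 hae)
    _ ≤ liminf (fun m => kinetic (ψ (s m)) + V (ψ (s m))) atTop := by
        -- Superadditivity of `liminf` is Fatou's lemma for counting measure on two points.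
        have h1 := lintegral_liminf_le (μ := Measure.count (α := Fin 2)) (u := atTop)
          (f := fun m : ℕ => ![kinetic (ψ (s m)), V (ψ (s m))]) (fun m => measurable_of_finite _)
        simpa [lintegral_count, Fin.sum_univ_two] using h1
    _ = sInf S := (hlim'.comp hs.tendsto_atTop).liminf_eq

end Minimizers

end CDFT

theorem theorem1 (n : ℕ) (ρ : CDFT.R3 → ℝ) (j : CDFT.R3 → CDFT.R3)
    (hY : (ρ, j) ∈ CDFT.Y (n + 1)) (hrep : CDFT.IsNRepresentable n ρ j) :
    (∃ ψ ∈ CDFT.W (n + 1), CDFT.Yields ψ ρ j ∧ CDFT.Q n ρ j = CDFT.energyH0 ψ) ∧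
      (∃ ψ ∈ CDFT.W (n + 1), CDFT.Yields ψ ρ j ∧ CDFT.Q' n ρ j = CDFT.kinetic ψ) := by
  refine ⟨CDFT.exists_minimizer hrep CDFT.coulomb fun f f₀ => CDFT.coulomb_le_liminf, ?_⟩
  simpa [CDFT.Q'] using CDFT.exists_minimizer hrep (fun _ => 0) fun _ _ _ _ _ => zero_le
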